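/- Let $A=\{A(i,j)\}_{i,j\in\mathbb N}$ be a $0$-$1$ matrix, $R_j=\{i: A(j,i)=1\}$, $C_j=\{i : A(i,j)=1\}$, and assume - (UCF) $\sup_{j}|C_j|<\infty$, and - (FS) for every $j$, the set $R_j$ or its complement $\mathbb N\setminus R_j$ is finite. Let $\mathcal O_A$ be the universal unital C\*-algebra generated by partial isometries $S_j$ ($j\in\mathbb N$) such that $S_i^*S_i$ and $S_j^*S_j$ commute, $S_i^*S_j=\delta_{i,j}S_i^*S_i$, $S_i^*S_iS_j=A(i,j)S_j$, and $$\prod_{i\in X}S_i^*S_i\prod_{j\in Y}(1-S_j^*S_j)=\sum_{k\in K(X,Y)}S_kS_k^*$$ for all finite $X,Y\subset\mathbb N$ for which $K(X,Y)=\{k : A(i,k)=1\ \forall i\in X,\ A(j,k)=0\ \forall j\in Y\}$ is finite. A finite word $\alpha=\alpha_1\cdots\alpha_n$ ($n\ge 0$) is admissible if $A(\alpha_k,\alpha_{k+1})=1$ for $1\le k<n$; put $S_\alpha=S_{\alpha_1}\cdots S_{\alpha_n}$, with $S_\alpha=1$ for the empty word. Let $$\mathcal A_A=\operatorname{span}\Big\{S_\alpha\Big(\prod_{i\in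 F}S_i^*S_i\Big)S_\beta^* : \alpha,\beta \text{ admissible},\ F\subset\mathbb N\text{ finite}\Big\}.$$ Let $\Sigma_A=\{x\in\mathbb N^{\mathbb N}: A(x_j,x_{j+1})=1\ \forall j\}$, and let $\pi:\mathcal O_A\to B(\ell^2(\Sigma_A))$ be the canonical representation, $\pi(S_i)\delta_x=\delta_{ix}$ if $A(i,x_1)=1$ and $\pi(S_i)\delta_x=0$ otherwise. **Proposition 3.5.** $\mathcal A_A$ is a dense unital $*$-subalgebra of $\mathcal O_A$. There is exactly one linear map $\gamma_A:\mathcal A_A\to\mathcal A_A$ with $\gamma_A(1)=1$ and $$\gamma_A(S_\alpha S_\beta^*)=\sum_{i=1}^\infty S_iS_\alpha S_\beta^*S_i^*$$ (a sum with only finitely many nonzero terms) for all admissible $\alpha,\beta$ with $S_\alpha S_\beta^*\neq 1$. This map is norm-contractive: $\|\gamma_A(f)\|\le\|f\|$ for all $f\in\mathcal A_A$. Hence it has a unique bounded linear extension $\gamma_A:\mathcal O_A\to\mathcal O_A$. The extension is unital and completely positive, and for all $f\in\mathcal O_A$ and $\xi\in\ell^2(\Sigma_A)$ $$\pi(\gamma_A(f))\xi=\lim_{n\to\infty}\pi\Big(\sum_{i=1}^n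 S_ifS_i^*\Big)\xi .$$ -/

import Mathlib

open scoped ENNReal CStarAlgebra

noncomputable section

namespace ExelLaca

/-! ### Conditions on a `0`-`1` matrix

The symbols are the natural numbers, and the entry `1` of a `0`-`1` matrix is `true`. -/

/-- The set `R_j = {i : A(j, i) = 1}`. -/
def row (A : ℕ → ℕ → Bool) (j : ℕ) : Set ℕ := {i | A j i = true}

/-- The set `C_j = {i : A(i, j) = 1}`. -/
def col (A : ℕ → ℕ → Bool) (j : ℕ) : Set ℕ := {i | A i j = true}

/-- (UCF): the numbers `|C_j|` are finite and bounded uniformly in `j`. -/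
def UniformlyColumnFinite (A : ℕ → ℕ → Bool) : Prop :=
  ∃ M : ℕ, ∀ j, (col A j).encard ≤ M

/-- (FS): for each symbol `j` the set `R_j` or its complement is finite. -/
def FinitelySummable (A : ℕ → ℕ → Bool) : Prop :=
  ∀ j, (row A j).Finite ∨ ((row A j)ᶜ).Finite

/-- Admissible finite words, among them the empty one: consecutive letters satisfy
`A(α_k, α_{k+1}) = 1`. -/
def Admissible (A : ℕ → ℕ → Bool) (α : List ℕ) : Prop :=
  α.IsChain (fun i j => A i j = true)

/-- The set of those `k` with `A(X, Y, k) = 1`. -/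
def common (A : ℕ → ℕ → Bool) (X Y : Finset ℕ) : Set ℕ :=
  {k | (∀ i ∈ X, A i k = true) ∧ (∀ j ∈ Y, A j k = false)}

/-! ### The Exel-Laca relations -/

theorem pairwise_commute {B : Type*} [Ring B] {f : ℕ → B} (h : ∀ i j, Commute (f i) (f j))
    (X : Finset ℕ) : (X : Set ℕ).Pairwise (Function.onFun Commute f) :=
  fun i _ j _ _ => h i j

theorem commute_one_sub {B : Type*} [Ring B] {f : ℕ → B} (h : ∀ i j, Commute (f i) (f j))
    (i j : ℕ) : Commute (1 - f i) (1 - f j) :=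
  (Commute.one_left _).sub_left ((Commute.one_right _).sub_right (h i j))

/-- The elements `S_j` of a unital `*`-ring are partial isometries that satisfy the four
Exel-Laca relations for the matrix `A`. -/
structure IsFamily (A : ℕ → ℕ → Bool) {B : Type*} [Ring B] [StarRing B] (S : ℕ → B) :
    Prop where
  partial_isometry : ∀ i, S i * star (S i) * S i = S i
  comm : ∀ i j, Commute (star (S i) * S i) (star (S j) * S j)
  orthogonal : ∀ i j, star (S i) * S j = if i = j then star (S i) * S i else 0
  transition : ∀ i j, star (S i) * S i * S j = if A i j = true then S j else 0
  finite_sum : ∀ (X Y : Finset ℕ) (h : (common A X Y).Finite),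
    X.noncommProd (fun i => star (S i) * S i) (pairwise_commute comm X) *
      Y.noncommProd (fun j => 1 - star (S j) * S j)
        (pairwise_commute (commute_one_sub comm) Y) =
    ∑ k ∈ h.toFinset, S k * star (S k)

/-- Such families are mapped to such families by unital `*`-homomorphisms. -/
theorem IsFamily.map {A : ℕ → ℕ → Bool} {B C : Type*} [Ring B] [StarRing B] [Algebra ℂ B]
    [Ring C] [StarRing C] [Algebra ℂ C] {S : ℕ → B} (hS : IsFamily A S) (f : B →⋆ₐ[ℂ] C) :
    IsFamily A (fun i => f (S i)) where
  partial_isometry i := by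
    rw [← map_star, ← map_mul, ← map_mul, hS.partial_isometry]
  comm i j := by
    simp only [← map_star, ← map_mul]
    exact (hS.comm i j).map f
  orthogonal i j := by
    rw [← map_star, ← map_mul, hS.orthogonal, ← map_mul]
    split_ifs <;> simp
  transition i j := by
    rw [← map_star, ← map_mul, ← map_mul, hS.transition]
    split_ifs <;> simp
  finite_sum X Y h := by
    have := congrArg f (hS.finite_sum X Y h)
    rw [map_mul, Finset.map_noncommProd, Finset.map_noncommProd, map_sum] at this
    simpa only [map_mul, map_sub, map_one, map_star] using this

theorem IsFamily.norm_le_one {A : ℕ → ℕ → Bool} {B : Type*} [CStarAlgebra B]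
    {S : ℕ → B} (hS : IsFamily A S) (i : ℕ) : ‖S i‖ ≤ 1 := by
  have h1 : ‖star (S i) * S i‖ = ‖S i‖ * ‖S i‖ := CStarRing.norm_star_mul_self
  have h2 : star (star (S i) * S i) * (star (S i) * S i) = star (S i) * S i := by
    rw [star_mul, star_star, mul_assoc, ← mul_assoc (S i), hS.partial_isometry]
  have h3 : ‖star (S i) * S i‖ = ‖star (S i) * S i‖ * ‖star (S i) * S i‖ := by
    conv_lhs => rw [← h2]
    exact CStarRing.norm_star_mul_self
  rw [h1] at h3
  by_contra hlt
  push Not at hlt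
  have h4 : 1 < ‖S i‖ * ‖S i‖ := one_lt_mul_of_lt_of_le hlt hlt.le
  nlinarith

/-! ### The universal unital C*-algebra of the relations

The C*-algebra is generated, inside the `ℓ^∞`-product of all unital C*-algebras with a family
that satisfies the relations, by the diagonal family. -/

/-- A nonzero unital C*-algebra with a family that satisfies the Exel-Laca relations. -/
structure Realization (A : ℕ → ℕ → Bool) : Type 1 where
  carrier : Type
  [cstar : CStarAlgebra carrier]
  [nontriv : Nontrivial carrier]
  S : ℕ → carrier
  isFamily : IsFamily A S

attribute [instance] Realization.cstar Realization.nontriv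

/-- The bounded families in the product of all realizations. -/
abbrev BigProduct (A : ℕ → ℕ → Bool) : Type 1 :=
  lp (fun r : Realization A => r.carrier) ∞

instance (A : ℕ → ℕ → Bool) : CStarAlgebra (BigProduct A) where

/-- The diagonal family. -/
def bigS (A : ℕ → ℕ → Bool) (i : ℕ) : BigProduct A :=
  ⟨fun r => r.S i, memℓp_infty ⟨1, by rintro _ ⟨r, rfl⟩; exact r.isFamily.norm_le_one i⟩⟩

/-- The closed unital `*`-subalgebra generated by the diagonal family. -/
def generated (A : ℕ → ℕ → Bool) : StarSubalgebra ℂ (BigProduct A) :=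
  (StarAlgebra.adjoin ℂ (Set.range (bigS A))).topologicalClosure

instance (A : ℕ → ℕ → Bool) : IsClosed (generated A : Set (BigProduct A)) :=
  StarSubalgebra.isClosed_topologicalClosure _

/-- The Exel-Laca algebra `𝒪_A`: the universal unital C*-algebra generated by partial isometries
that satisfy the Exel-Laca relations. -/
def Alg (A : ℕ → ℕ → Bool) : Type 1 := generated A

instance (A : ℕ → ℕ → Bool) : CStarAlgebra (Alg A) :=
  inferInstanceAs (CStarAlgebra (generated A))

/-- The C*-algebraic order. -/
instance (A : ℕ → ℕ → Bool) : PartialOrder (Alg A) := CStarAlgebra.spectralOrder _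

instance (A : ℕ → ℕ → Bool) : StarOrderedRing (Alg A) := CStarAlgebra.spectralOrderedRing _

/-- The generators `S_j` of `𝒪_A`. -/
def S (A : ℕ → ℕ → Bool) (i : ℕ) : Alg A :=
  ⟨bigS A i, subset_closure (StarAlgebra.subset_adjoin ℂ _ ⟨i, rfl⟩)⟩

/-- The coordinate `*`-homomorphisms. -/
def eval (A : ℕ → ℕ → Bool) (r : Realization A) : Alg A →⋆ₐ[ℂ] r.carrier where
  toFun x := (x.1 : BigProduct A) r
  map_one' := rfl
  map_mul' _ _ := rfl
  map_zero' := rfl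
  map_add' _ _ := rfl
  commutes' _ := rfl
  map_star' _ := rfl

theorem eval_S (A : ℕ → ℕ → Bool) (r : Realization A) (i : ℕ) : eval A r (S A i) = r.S i := rfl

theorem ext_eval {A : ℕ → ℕ → Bool} {x y : Alg A} (h : ∀ r, eval A r x = eval A r y) :
    x = y :=
  Subtype.ext (lp.ext (funext h))

/-- The generators of `𝒪_A` satisfy the relations. -/
theorem isFamily_S (A : ℕ → ℕ → Bool) : IsFamily A (S A) where
  partial_isometry i := ext_eval fun r => by
    simpa only [map_mul, map_star, eval_S] using r.isFamily.partial_isometry i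
  comm i j := ext_eval fun r => by
    simpa only [map_mul, map_star, eval_S] using (r.isFamily.comm i j).eq
  orthogonal i j := ext_eval fun r => by
    rw [apply_ite (eval A r)]
    simpa only [map_mul, map_star, eval_S, map_zero] using r.isFamily.orthogonal i j
  transition i j := ext_eval fun r => by
    rw [apply_ite (eval A r)]
    simpa only [map_mul, map_star, eval_S, map_zero] using r.isFamily.transition i j
  finite_sum X Y h := ext_eval fun r => by
    rw [map_mul, Finset.map_noncommProd, Finset.map_noncommProd, map_sum]
    simpa only [map_mul, map_sub, map_one, map_star, eval_S] using r.isFamily.finite_sum X Y h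

open Classical in
/-- The universal property: a family in a unital C*-algebra that satisfies the relations is the
image of the generators under a unital `*`-homomorphism. -/
def lift {A : ℕ → ℕ → Bool} {B : Type} [CStarAlgebra B] (T : ℕ → B) (hT : IsFamily A T) :
    Alg A →⋆ₐ[ℂ] B :=
  if h : Nontrivial B then eval A ⟨B, T, hT⟩
  else
    have : Subsingleton B := not_nontrivial_iff_subsingleton.mp h
    { toFun := fun _ => 0
      map_one' := Subsingleton.elim _ _
      map_mul' := fun _ _ => Subsingleton.elim _ _
      map_zero' := Subsingleton.elim _ _
      map_add' := fun _ _ => Subsingleton.elim _ _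
      commutes' := fun _ => Subsingleton.elim _ _
      map_star' := fun _ => Subsingleton.elim _ _ }

theorem lift_S {A : ℕ → ℕ → Bool} {B : Type} [CStarAlgebra B] (T : ℕ → B)
    (hT : IsFamily A T) (i : ℕ) : lift T hT (S A i) = T i := by
  by_cases h : Nontrivial B
  · rw [lift, dif_pos h]
    rfl
  · have : Subsingleton B := not_nontrivial_iff_subsingleton.mp h
    exact Subsingleton.elim _ _

/-! ### The dense `*`-subalgebra and the map `γ_A` on it -/

/-- `S_α = S_{α_1} ⋯ S_{α_n}` for a word `α`, and `1` for the empty word. -/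
def word (A : ℕ → ℕ → Bool) (α : List ℕ) : Alg A := (α.map (S A)).prod

/-- `∏_{i ∈ F} S_i^* S_i`, a product of commuting projections. -/
def proj (A : ℕ → ℕ → Bool) (F : Finset ℕ) : Alg A :=
  F.noncommProd (fun i => star (S A i) * S A i) (pairwise_commute (isFamily_S A).comm F)

/-- `𝒜_A`, the span of the elements `S_α (∏_{i ∈ F} S_i^* S_i) S_β^*` over admissible finite words
`α`, `β` and finite sets `F` of symbols. -/
def core (A : ℕ → ℕ → Bool) : Submodule ℂ (Alg A) :=
  Submodule.span ℂ {x | ∃ α β : List ℕ, ∃ F : Finset ℕ, Admissible A α ∧ Admissible A β ∧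
    x = word A α * proj A F * star (word A β)}

/-- The linear map `γ` on `𝒜_A` satisfies `γ(1) = 1` and, for each element `x = S_α S_β^* ≠ 1`
with admissible words `α` and `β`, `γ(x) = ∑_i S_i x S_i^*`, where only finitely many
summands are nonzero. -/
structure IsGamma (A : ℕ → ℕ → Bool) (γ : core A →ₗ[ℂ] core A) : Prop where
  map_one : ∀ x : core A, (x : Alg A) = 1 → (γ x : Alg A) = 1
  map_word : ∀ (α β : List ℕ), Admissible A α → Admissible A β →
    ∀ x : core A, (x : Alg A) = word A α * star (word A β) → (x : Alg A) ≠ 1 →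
      (Function.support fun i => S A i * (x : Alg A) * star (S A i)).Finite ∧
      (γ x : Alg A) = ∑ᶠ i, S A i * (x : Alg A) * star (S A i)

/-! ### The canonical representation -/

/-- The Markov shift `Σ_A`. -/
def Shift (A : ℕ → ℕ → Bool) : Type := {x : ℕ → ℕ // ∀ j, A (x j) (x (j + 1)) = true}

/-- The left shift on `Σ_A`. -/
def Shift.tail {A : ℕ → ℕ → Bool} (x : Shift A) : Shift A :=
  ⟨fun j => x.1 (j + 1), fun j => x.2 (j + 1)⟩

/-- The sequence `i x` for `x` in `Σ_A` with `A(i, x_1) = 1`. -/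
def Shift.cons {A : ℕ → ℕ → Bool} (i : ℕ) (x : Shift A) (h : A i (x.1 0) = true) : Shift A :=
  ⟨fun j => Nat.casesOn j i x.1, fun j => by cases j with
    | zero => exact h
    | succ j => exact x.2 j⟩

theorem Shift.ext_tail {A : ℕ → ℕ → Bool} {x y : Shift A} (h0 : x.1 0 = y.1 0)
    (h : x.tail = y.tail) : x = y := by
  refine Subtype.ext (funext fun j => ?_)
  cases j with
  | zero => exact h0
  | succ j => exact congrFun (congrArg Subtype.val h) j

/-- The Hilbert space `ℓ²(Σ_A)`. -/
abbrev Hilb (A : ℕ → ℕ → Bool) : Type := lp (fun _ : Shift A => ℂ) 2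

open Classical in
/-- The vector `δ_x` of the canonical orthonormal basis of `ℓ²(Σ_A)`. -/
def delta {A : ℕ → ℕ → Bool} (x : Shift A) : Hilb A := lp.single 2 x (1 : ℂ)

theorem sum_shiftFun_le {A : ℕ → ℕ → Bool} (i : ℕ) (ξ : Hilb A) (s : Finset (Shift A)) :
    ∑ y ∈ s, ‖if y.1 0 = i then ξ y.tail else 0‖ ^ (2 : ℝ≥0∞).toReal ≤
      ‖ξ‖ ^ (2 : ℝ≥0∞).toReal := by
  classical
  have h2 : (0 : ℝ) < (2 : ℝ≥0∞).toReal := by norm_num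
  have hinj : Set.InjOn (Shift.tail : Shift A → Shift A) (s.filter fun y => y.1 0 = i) := by
    intro x hx y hy hxy
    simp only [Finset.coe_filter, Set.mem_ofPred_eq] at hx hy
    exact Shift.ext_tail (hx.2.trans hy.2.symm) hxy
  calc ∑ y ∈ s, ‖if y.1 0 = i then ξ y.tail else 0‖ ^ (2 : ℝ≥0∞).toReal
      = ∑ y ∈ s.filter (fun y => y.1 0 = i), ‖ξ y.tail‖ ^ (2 : ℝ≥0∞).toReal := by
        rw [Finset.sum_filter]
        refine Finset.sum_congr rfl fun y _ => ?_
        split_ifs <;> simp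
    _ = ∑ z ∈ (s.filter (fun y => y.1 0 = i)).image Shift.tail,
          ‖ξ z‖ ^ (2 : ℝ≥0∞).toReal := (Finset.sum_image (f := fun z => ‖ξ z‖ ^ (2 : ℝ≥0∞).toReal) hinj).symm
    _ ≤ _ := lp.sum_rpow_le_norm_rpow h2 ξ _

/-- The operator `T_i` on `ℓ²(Σ_A)`: the value of `T_i ξ` at `y` is `ξ(σ y)` if `y_1 = i`, and
`0` otherwise. -/
def T (A : ℕ → ℕ → Bool) (i : ℕ) : Hilb A →L[ℂ] Hilb A :=
  LinearMap.mkContinuous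
    { toFun := fun ξ => ⟨fun y => if y.1 0 = i then ξ y.tail else 0,
        memℓp_gen' (sum_shiftFun_le i ξ)⟩
      map_add' := fun ξ η => by
        ext y
        change (if y.1 0 = i then (ξ + η) y.tail else 0) =
          (if y.1 0 = i then ξ y.tail else 0) + (if y.1 0 = i then η y.tail else 0)
        split_ifs <;> simp
      map_smul' := fun c ξ => by
        ext y
        change (if y.1 0 = i then (c • ξ) y.tail else 0) =
          c • (if y.1 0 = i then ξ y.tail else 0)
        split_ifs <;> simp } 1
    (fun ξ => by
      rw [one_mul]
      exact lp.norm_le_of_forall_sum_le (by norm_num) (norm_nonneg _) (sum_shiftFun_le i ξ))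

theorem T_apply {A : ℕ → ℕ → Bool} (i : ℕ) (ξ : Hilb A) (y : Shift A) :
    T A i ξ y = if y.1 0 = i then ξ y.tail else 0 := rfl

open Classical in
theorem delta_apply {A : ℕ → ℕ → Bool} (x y : Shift A) :
    delta x y = if y = x then 1 else 0 := by
  rw [delta, lp.single_apply, Pi.single_apply]

/-- `T_i δ_x` is `δ_{ix}` if `A(i, x_1) = 1`, and `0` otherwise. -/
theorem T_delta {A : ℕ → ℕ → Bool} (i : ℕ) (x : Shift A) :
    T A i (delta x) = if h : A i (x.1 0) = true then delta (x.cons i h) else 0 := by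
  classical
  ext y
  rw [T_apply, delta_apply]
  split_ifs with h1 h2 h3 h3
  · rw [delta_apply, if_pos]
    exact Shift.ext_tail h1 h2
  · exfalso
    apply h3
    rw [← h2, ← h1]
    exact y.2 0
  · rw [delta_apply, if_neg]
    rintro rfl
    exact h2 rfl
  · rfl
  · rw [delta_apply, if_neg]
    rintro rfl
    exact h1 rfl
  · rfl

theorem inner_delta {A : ℕ → ℕ → Bool} (x : Shift A) (ξ : Hilb A) :
    inner ℂ (delta x) ξ = ξ x := by
  classical
  rw [delta, lp.inner_single_left]
  simp

theorem star_T_apply {A : ℕ → ℕ → Bool} (i : ℕ) (ξ : Hilb A) (x : Shift A) :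
    (star (T A i)) ξ x = if h : A i (x.1 0) = true then ξ (x.cons i h) else 0 := by
  rw [← inner_delta, ContinuousLinearMap.star_eq_adjoint, ContinuousLinearMap.adjoint_inner_right,
    T_delta]
  split_ifs
  · rw [inner_delta]
  · rw [inner_zero_left]

theorem star_T_mul_T_apply {A : ℕ → ℕ → Bool} (i : ℕ) (ξ : Hilb A) (x : Shift A) :
    (star (T A i) * T A i) ξ x = if A i (x.1 0) = true then ξ x else 0 := by
  rw [mul_apply_eq_comp, star_T_apply]
  split_ifs with h
  · rw [T_apply]
    exact if_pos rfl
  · rfl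

theorem T_mul_star_T_apply {A : ℕ → ℕ → Bool} (i : ℕ) (ξ : Hilb A) (x : Shift A) :
    (T A i * star (T A i)) ξ x = if x.1 0 = i then ξ x else 0 := by
  rw [mul_apply_eq_comp, T_apply]
  split_ifs with h
  · have h' : A i (x.tail.1 0) = true := h ▸ x.2 0
    rw [star_T_apply, dif_pos h']
    have hx : Shift.cons i x.tail h' = x := Shift.ext_tail h.symm rfl
    rw [hx]
  · rfl

/-- The operators `T_i` satisfy the Exel-Laca relations. -/
theorem isFamily_T (A : ℕ → ℕ → Bool) : IsFamily A (T A) where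
  partial_isometry i := by
    ext ξ x
    rw [mul_apply_eq_comp, T_mul_star_T_apply, T_apply]
    split_ifs <;> rfl
  comm i j := by
    ext ξ x
    simp only [mul_apply_eq_comp (star (T A i) * T A i),
      mul_apply_eq_comp (star (T A j) * T A j), star_T_mul_T_apply]
    split_ifs <;> rfl
  orthogonal i j := by
    split_ifs with h
    · rw [h]
    · ext ξ x
      rw [mul_apply_eq_comp, star_T_apply]
      split_ifs with h'
      · rw [T_apply, if_neg]
        · rfl
        · exact h
      · rfl
  transition i j := by
    ext ξ x
    rw [mul_apply_eq_comp, star_T_mul_T_apply, T_apply]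
    by_cases h0 : x.1 0 = j
    · subst h0
      by_cases h1 : A i (x.1 0) = true
      · rw [if_pos h1, if_pos h1, T_apply]
      · rw [if_neg h1, if_neg h1]
        rfl
    · rw [if_neg h0, ite_self]
      split_ifs
      · rw [T_apply, if_neg h0]
      · rfl
  finite_sum X Y hXY := by
    have hX : ∀ (Z : Finset ℕ) (hZ) (ξ : Hilb A) (x : Shift A),
        (Z.noncommProd (fun i => star (T A i) * T A i) hZ) ξ x =
          if ∀ i ∈ Z, A i (x.1 0) = true then ξ x else 0 := by
      intro Z
      induction Z using Finset.induction_on with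
      | empty => intro hZ ξ x; simp
      | insert a Z ha ih =>
        intro hZ ξ x
        rw [Finset.noncommProd_insert_of_notMem _ _ _ _ ha, mul_apply_eq_comp,
          star_T_mul_T_apply, ih]
        simp only [Finset.forall_mem_insert]
        split_ifs <;> simp_all
    have hY : ∀ (Z : Finset ℕ) (hZ) (ξ : Hilb A) (x : Shift A),
        (Z.noncommProd (fun i => 1 - star (T A i) * T A i) hZ) ξ x =
          if ∀ i ∈ Z, A i (x.1 0) = false then ξ x else 0 := by
      intro Z
      induction Z using Finset.induction_on with
      | empty => intro hZ ξ x; simp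
      | insert a Z ha ih =>
        intro hZ ξ x
        rw [Finset.noncommProd_insert_of_notMem _ _ _ _ ha, mul_apply_eq_comp,
          sub_apply, lp.coeFn_sub, Pi.sub_apply, star_T_mul_T_apply,
          one_apply_eq_self, ih]
        simp only [Finset.forall_mem_insert]
        generalize ξ x = c
        generalize A a (x.1 0) = b
        cases b <;> simp
    have hS : ∀ (Z : Finset ℕ) (ξ : Hilb A) (x : Shift A),
        (∑ k ∈ Z, T A k * star (T A k)) ξ x = if x.1 0 ∈ Z then ξ x else 0 := by
      intro Z
      induction Z using Finset.induction_on with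
      | empty => intro ξ x; simp
      | insert a Z ha ih =>
        intro ξ x
        rw [Finset.sum_insert ha, add_apply, lp.coeFn_add, Pi.add_apply,
          T_mul_star_T_apply, ih]
        simp only [Finset.mem_insert]
        by_cases h1 : x.1 0 = a
        · rw [if_pos h1, if_neg (h1 ▸ ha), if_pos (Or.inl h1), add_zero]
        · simp only [h1, if_false, false_or, zero_add]
    ext ξ x
    rw [mul_apply_eq_comp, hX, hY, hS]
    simp only [Set.Finite.mem_toFinset, common, Set.mem_ofPred_eq]
    generalize ξ x = c
    rw [ite_and]

/-- The canonical representation of `𝒪_A` on `ℓ²(Σ_A)`, with `π(S_i) = T_i`. -/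
def canonicalRep (A : ℕ → ℕ → Bool) : Alg A →⋆ₐ[ℂ] (Hilb A →L[ℂ] Hilb A) :=
  lift (T A) (isFamily_T A)

end ExelLaca

end

/-! The algebra `𝒜_A` is the `*`-algebra generated by the `S_i`: by (FS), each `S_i^* S_i` is a
finite sum of range projections `S_k S_k^*` or `1` minus such a sum, so the span of the elements
`S_α S_β^*` is stable under left multiplication by `S_i` and `S_i^*` (`adjoin_mul_mem_wordSpan`),
and hence equals both `𝒜_A` and the generated `*`-algebra (`coe_adjoin_eq_core`), which is dense.

The map `γ_A` is the pointwise norm limit of the unital maps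
`Ψ_n(f) = ∑_{i < n} S_i f S_i^* + Q_n f Q_n`, where `Q_n = 1 - ∑_{i < n} S_i S_i^*`. The operators
`S_i` (`i < n`) and `Q_n` have orthogonal ranges and the sum of their range projections is `1`, so
that `Ψ_n` is contractive (`norm_sum_conj_le`) and completely positive (`map_conj_nonneg`). By
column finiteness `S_i S_α = 0` for all large `i` if `α` is not empty, and also `Q_n S_α = 0` for
all large `n`. Hence `Ψ_n(S_α S_β^*)` is eventually `∑_i S_i S_α S_β^* S_i^*` unless both words are
empty (`exists_approx_word_eq`), while `Ψ_n(1) = 1`. So the maps `Ψ_n` are eventually constant at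
each point of `𝒜_A`, and since they are contractive they converge everywhere. That the limit is
well defined, linear, contractive, unital and completely positive needs no discussion of linear
relations among the elements `S_α S_β^*`.

In the canonical representation `Q_n` is the projection onto the sequences with `x_1 ≥ n`, which
tends strongly to `0`; so the terms `Q_n f Q_n` disappear in the point-strong limit. -/

namespace ExelLaca

open Filter Topology

/-! ### Conjugation sums in a C*-algebra -/

section Conjugation

variable {B : Type*} [CStarAlgebra B] [PartialOrder B] [StarOrderedRing B]

/-- Since the summands have orthogonal ranges, `x = ∑ V f V^*` satisfies the Schwarz inequality
`x^* x ≤ ∑ V (f^* f) V^*`, and the right-hand side is at most `‖f‖²`. -/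
theorem norm_sum_conj_le {ι : Type*} (s : Finset ι) (V : ι → B)
    (horth : ∀ k ∈ s, ∀ l ∈ s, k ≠ l → star (V k) * V l = 0)
    (hle : ∀ k ∈ s, star (V k) * V k ≤ 1) (hsum : ∑ k ∈ s, V k * star (V k) ≤ 1) (f : B) :
    ‖∑ k ∈ s, V k * f * star (V k)‖ ≤ ‖f‖ := by
  set x := ∑ k ∈ s, V k * f * star (V k) with hx
  have h1 : star x * x = ∑ k ∈ s, V k * (star f * (star (V k) * V k) * f) * star (V k) := by
    rw [hx, star_sum, Finset.sum_mul_sum]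
    refine Finset.sum_congr rfl fun k hk => ?_
    rw [Finset.sum_eq_single_of_mem k hk]
    · simp only [star_mul, star_star, mul_assoc]
    · intro l hl hlk
      rw [star_mul, star_mul, star_star, mul_assoc, mul_assoc, ← mul_assoc (star (V k)),
        ← mul_assoc (star (V k)), horth k hk l hl hlk.symm]
      simp
  have h2 : star f * f ≤ algebraMap ℝ B (‖f‖ * ‖f‖) := by
    rw [← CStarRing.norm_star_mul_self (x := f)]
    exact (IsSelfAdjoint.star_mul_self f).le_algebraMap_norm_self
  have h3 : star x * x ≤ algebraMap ℝ B (‖f‖ * ‖f‖) := by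
    calc star x * x ≤ ∑ k ∈ s, V k * algebraMap ℝ B (‖f‖ * ‖f‖) * star (V k) := by
          rw [h1]
          refine Finset.sum_le_sum fun k hk => star_right_conjugate_le_conjugate (le_trans ?_ h2) _
          simpa using star_left_conjugate_le_conjugate (hle k hk) f
      _ = (‖f‖ * ‖f‖) • ∑ k ∈ s, V k * star (V k) := by
          rw [Finset.smul_sum]
          refine Finset.sum_congr rfl fun k _ => ?_
          rw [← Algebra.commutes, mul_assoc, Algebra.smul_def]
      _ ≤ (‖f‖ * ‖f‖) • (1 : B) :=
          smul_le_smul_of_nonneg_left hsum (mul_nonneg (norm_nonneg _) (norm_nonneg _))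
      _ = _ := (Algebra.algebraMap_eq_smul_one _).symm
  have h4 : ‖star x * x‖ ≤ ‖f‖ * ‖f‖ :=
    (CStarAlgebra.norm_le_iff_le_algebraMap _ (mul_nonneg (norm_nonneg _) (norm_nonneg _))
      (star_mul_self_nonneg x)).2 h3
  rw [CStarRing.norm_star_mul_self] at h4
  exact le_of_sq_le_sq (by simpa [sq] using h4) (norm_nonneg _)

/-- Entrywise, `f ↦ V f V^*` is conjugation by the diagonal matrix with entries `V`. -/
theorem map_conj_nonneg (V : B) {k : ℕ} {M : CStarMatrix (Fin k) (Fin k) B} (hM : 0 ≤ M) :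
    0 ≤ M.map (fun f => V * f * star V) := by
  let D : CStarMatrix (Fin k) (Fin k) B := CStarMatrix.ofMatrix (Matrix.diagonal fun _ => V)
  have h : M.map (fun f => V * f * star V) = D * M * star D := by
    ext i j
    simp [D, CStarMatrix.mul_apply, CStarMatrix.star_apply, Matrix.diagonal_apply,
      apply_ite star]
  rw [h]
  exact star_right_conjugate_nonneg hM D

/-- Complete positivity passes to pointwise norm limits. -/
theorem map_nonneg_of_tendsto {Ψ : ℕ → B → B} {γ : B → B}
    (h : ∀ f, Tendsto (fun n => Ψ n f) atTop (𝓝 (γ f))) {k : ℕ}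
    {M : CStarMatrix (Fin k) (Fin k) B} (hM : ∀ n, 0 ≤ M.map (Ψ n)) : 0 ≤ M.map γ := by
  have ht : Tendsto (fun n => M.map (Ψ n)) atTop (𝓝 (M.map γ)) := by
    refine tendsto_pi_nhds.2 fun i => tendsto_pi_nhds.2 fun j => ?_
    exact h (M i j)
  exact ge_of_tendsto' ht hM

end Conjugation

/-! ### Unital approximations of `γ_A` -/

section Approximation

variable {A : ℕ → ℕ → Bool} {B : Type*} [CStarAlgebra B] {S : ℕ → B}

/-- `Q_n = 1 - ∑_{i < n} S_i S_i^*`. -/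
def gap (S : ℕ → B) (n : ℕ) : B := 1 - ∑ i ∈ Finset.range n, S i * star (S i)

theorem star_gap (S : ℕ → B) (n : ℕ) : star (gap S n) = gap S n := by
  simp [gap, star_sum]

theorem IsFamily.gap_mul (hS : IsFamily A S) {n i : ℕ} (hi : i < n) : gap S n * S i = 0 := by
  rw [gap, sub_mul, one_mul, Finset.sum_mul,
    Finset.sum_eq_single_of_mem i (Finset.mem_range.2 hi), hS.partial_isometry, sub_self]
  intro j _ hj
  rw [mul_assoc, hS.orthogonal, if_neg hj, mul_zero]

theorem IsFamily.star_mul_gap (hS : IsFamily A S) {n i : ℕ} (hi : i < n) :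
    star (S i) * gap S n = 0 := by
  rw [← star_gap, ← star_mul, hS.gap_mul hi, star_zero]

theorem IsFamily.gap_mul_gap (hS : IsFamily A S) (n : ℕ) : gap S n * gap S n = gap S n := by
  conv_lhs => rw [gap.eq_1 S n, mul_sub, ← gap.eq_1 S n, mul_one, Finset.mul_sum]
  rw [Finset.sum_eq_zero, sub_zero]
  intro i hi
  rw [← mul_assoc, hS.gap_mul (Finset.mem_range.1 hi), zero_mul]

/-- The map `f ↦ ∑_{i < n} S_i f S_i^* + Q_n f Q_n`. -/
noncomputable def approx (S : ℕ → B) (n : ℕ) : B →L[ℂ] B :=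
  ∑ i ∈ Finset.range n, ContinuousLinearMap.mulLeftRight ℂ B (S i) (star (S i)) +
    ContinuousLinearMap.mulLeftRight ℂ B (gap S n) (gap S n)

theorem approx_apply (S : ℕ → B) (n : ℕ) (f : B) :
    approx S n f = ∑ i ∈ Finset.range n, S i * f * star (S i) + gap S n * f * gap S n := by
  simp [approx]

theorem IsFamily.approx_one (hS : IsFamily A S) (n : ℕ) : approx S n 1 = 1 := by
  simp only [approx_apply, mul_one, hS.gap_mul_gap]
  exact add_sub_cancel _ _

/-- The operators that implement `approx S n`: `S_i` for `i < n`, and then `Q_n`. -/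
def approxKraus (S : ℕ → B) (n k : ℕ) : B := if k < n then S k else gap S n

theorem approx_eq_sum (S : ℕ → B) (n : ℕ) (f : B) :
    approx S n f =
      ∑ k ∈ Finset.range (n + 1), approxKraus S n k * f * star (approxKraus S n k) := by
  rw [Finset.sum_range_succ, approx_apply]
  congr 1
  · refine Finset.sum_congr rfl fun k hk => ?_
    rw [approxKraus, if_pos (Finset.mem_range.1 hk)]
  · rw [approxKraus, if_neg (lt_irrefl n), star_gap]

variable [PartialOrder B] [StarOrderedRing B]

theorem IsFamily.norm_approx_apply_le (hS : IsFamily A S) (n : ℕ) (f : B) :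
    ‖approx S n f‖ ≤ ‖f‖ := by
  have hle : ∀ p : B, star p = p → p * p = p → p ≤ 1 := fun p hp hpp =>
    IsStarProjection.le_one ⟨hpp, hp⟩
  rw [approx_eq_sum]
  refine norm_sum_conj_le _ _ ?_ ?_ ?_ f
  · intro k _ l _ hkl
    simp only [approxKraus]
    split_ifs with h1 h2 h2
    · rw [hS.orthogonal, if_neg hkl]
    · exact hS.star_mul_gap h1
    · rw [star_gap, hS.gap_mul h2]
    · simp only [Finset.mem_range] at *
      omega
  · intro k _
    simp only [approxKraus]
    split_ifs with h1
    · refine hle _ (by simp) ?_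
      rw [mul_assoc, ← mul_assoc (S k), hS.partial_isometry]
    · rw [star_gap, hS.gap_mul_gap]
      exact hle _ (star_gap S n) (hS.gap_mul_gap n)
  · have h := approx_eq_sum S n 1
    rw [hS.approx_one] at h
    simp only [mul_one] at h
    exact h.ge

theorem map_approx_nonneg (S : ℕ → B) (n : ℕ) {k : ℕ} {M : CStarMatrix (Fin k) (Fin k) B}
    (hM : 0 ≤ M) : 0 ≤ M.map (approx S n) := by
  have h : M.map (approx S n) = ∑ l ∈ Finset.range (n + 1),
      M.map (fun f => approxKraus S n l * f * star (approxKraus S n l)) := by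
    ext i j
    have h2 : ∀ (s : Finset ℕ) (N : ℕ → CStarMatrix (Fin k) (Fin k) B),
        (∑ l ∈ s, N l) i j = ∑ l ∈ s, N l i j := by
      intro s N
      induction s using Finset.cons_induction with
      | empty => simp
      | cons a s ha ih => rw [Finset.sum_cons, Finset.sum_cons, CStarMatrix.add_apply, ih]
    rw [h2, CStarMatrix.map_apply, approx_eq_sum]
    rfl
  rw [h]
  exact Finset.sum_nonneg fun l _ => map_conj_nonneg _ hM

end Approximation

/-! ### The dense `*`-subalgebra -/

section Core

variable {A : ℕ → ℕ → Bool}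

@[simp]
theorem word_nil : word A [] = 1 := rfl

theorem word_cons (i : ℕ) (α : List ℕ) : word A (i :: α) = S A i * word A α := by
  simp [word]

theorem word_append_singleton (α : List ℕ) (i : ℕ) : word A (α ++ [i]) = word A α * S A i := by
  simp [word]

theorem S_mul_S_eq_zero {i j : ℕ} (h : A i j ≠ true) : S A i * S A j = 0 := by
  rw [← (isFamily_S A).partial_isometry i, mul_assoc, mul_assoc, ← mul_assoc (star _),
    (isFamily_S A).transition, if_neg h, mul_zero]

theorem word_eq_zero {α : List ℕ} (h : ¬ Admissible A α) : word A α = 0 := by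
  induction α with
  | nil => exact absurd List.isChain_nil h
  | cons i α ih =>
    cases α with
    | nil => exact absurd (List.isChain_singleton i) h
    | cons j α =>
      by_cases h1 : A i j = true
      · rw [word_cons, ih fun h2 => h (List.isChain_cons_cons.2 ⟨h1, h2⟩), mul_zero]
      · rw [word_cons, word_cons, ← mul_assoc, S_mul_S_eq_zero h1, zero_mul]

/-- The span of the elements `S_α S_β^*` over all words; the words that are not admissible
contribute `0`. -/
noncomputable def wordSpan (A : ℕ → ℕ → Bool) : Submodule ℂ (Alg A) :=
  Submodule.span ℂ {x | ∃ α β : List ℕ, x = word A α * star (word A β)}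

theorem word_mem_wordSpan (α β : List ℕ) : word A α * star (word A β) ∈ wordSpan A :=
  Submodule.subset_span ⟨α, β, rfl⟩

theorem wordSpan_le_core : wordSpan A ≤ core A := by
  refine Submodule.span_le.2 ?_
  rintro _ ⟨α, β, rfl⟩
  by_cases hα : Admissible A α
  · by_cases hβ : Admissible A β
    · exact Submodule.subset_span ⟨α, β, ∅, hα, hβ, by simp [proj]⟩
    · simp [word_eq_zero hβ]
  · simp [word_eq_zero hα]

/-- By (FS), `S_i^* S_i` or `1 - S_i^* S_i` is a finite sum of range projections. -/
theorem star_S_mul_S_mul_star_word_mem (hFS : FinitelySummable A) (i : ℕ) (β : List ℕ) :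
    star (S A i) * S A i * star (word A β) ∈ wordSpan A := by
  have hsum : ∀ s : Finset ℕ, (∑ k ∈ s, S A k * star (S A k)) * star (word A β) ∈ wordSpan A := by
    intro s
    rw [Finset.sum_mul]
    refine Submodule.sum_mem _ fun k _ => ?_
    have h := word_mem_wordSpan (A := A) [k] (β ++ [k])
    rwa [word_append_singleton, star_mul, word_cons, word_nil, mul_one, ← mul_assoc] at h
  rcases hFS i with h | h
  · have h' : (common A {i} ∅).Finite := h.subset fun k hk => by simpa [common, row] using hk
    have h2 := (isFamily_S A).finite_sum _ _ h'
    simp only [Finset.noncommProd_singleton, Finset.noncommProd_empty, mul_one] at h2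
    rw [h2]
    exact hsum _
  · have h' : (common A ∅ {i}).Finite := h.subset fun k hk => by simpa [common, row] using hk
    have h2 := (isFamily_S A).finite_sum _ _ h'
    simp only [Finset.noncommProd_singleton, Finset.noncommProd_empty, one_mul] at h2
    have h3 : star (S A i) * S A i = 1 - ∑ k ∈ h'.toFinset, S A k * star (S A k) := by
      rw [← h2, sub_sub_cancel]
    rw [h3, sub_mul]
    refine Submodule.sub_mem _ ?_ (hsum _)
    simpa using word_mem_wordSpan (A := A) [] β

theorem S_mul_mem_wordSpan (i : ℕ) {x : Alg A} (hx : x ∈ wordSpan A) :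
    S A i * x ∈ wordSpan A := by
  induction hx using Submodule.span_induction with
  | mem x hx =>
    obtain ⟨α, β, rfl⟩ := hx
    rw [← mul_assoc, ← word_cons]
    exact word_mem_wordSpan _ _
  | zero => simp
  | add x y _ _ hx hy => rw [mul_add]; exact add_mem hx hy
  | smul c x _ hx => rw [mul_smul_comm]; exact Submodule.smul_mem _ _ hx

theorem star_S_mul_mem_wordSpan (hFS : FinitelySummable A) (i : ℕ) {x : Alg A}
    (hx : x ∈ wordSpan A) : star (S A i) * x ∈ wordSpan A := by
  induction hx using Submodule.span_induction with
  | mem x hx =>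
    obtain ⟨α, β, rfl⟩ := hx
    cases α with
    | nil =>
      rw [word_nil, one_mul, ← star_mul, ← word_append_singleton]
      simpa using word_mem_wordSpan (A := A) [] (β ++ [i])
    | cons j α =>
      rw [word_cons, ← mul_assoc, ← mul_assoc, (isFamily_S A).orthogonal]
      split_ifs with hij
      · cases α with
        | nil =>
          rw [word_nil, mul_one]
          exact star_S_mul_S_mul_star_word_mem hFS i β
        | cons k α =>
          rw [word_cons, ← mul_assoc, (isFamily_S A).transition]
          split_ifs
          · rw [← word_cons]
            exact word_mem_wordSpan _ _
          · simp
      · simp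
  | zero => simp
  | add x y _ _ hx hy => rw [mul_add]; exact add_mem hx hy
  | smul c x _ hx => rw [mul_smul_comm]; exact Submodule.smul_mem _ _ hx

theorem adjoin_mul_mem_wordSpan (hFS : FinitelySummable A) {a : Alg A}
    (ha : a ∈ StarAlgebra.adjoin ℂ (Set.range (S A))) :
    ∀ x ∈ wordSpan A, a * x ∈ wordSpan A := by
  rw [← StarSubalgebra.mem_toSubalgebra, StarAlgebra.adjoin_toSubalgebra] at ha
  induction ha using Algebra.adjoin_induction with
  | mem a ha =>
    intro x hx
    rcases ha with ⟨i, rfl⟩ | ⟨i, hi⟩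
    · exact S_mul_mem_wordSpan i hx
    · rw [← star_star a, ← hi]
      exact star_S_mul_mem_wordSpan hFS i hx
  | algebraMap c =>
    intro x hx
    rw [← Algebra.smul_def]
    exact Submodule.smul_mem _ _ hx
  | add a b _ _ ha hb => intro x hx; rw [add_mul]; exact add_mem (ha x hx) (hb x hx)
  | mul a b _ _ ha hb => intro x hx; rw [mul_assoc]; exact ha _ (hb x hx)

theorem word_mem_adjoin (α : List ℕ) :
    word A α ∈ StarAlgebra.adjoin ℂ (Set.range (S A)) := by
  refine list_prod_mem fun x hx => ?_
  obtain ⟨i, _, rfl⟩ := List.mem_map.1 hx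
  exact StarAlgebra.subset_adjoin ℂ _ ⟨i, rfl⟩

theorem core_le_adjoin {x : Alg A} (hx : x ∈ core A) :
    x ∈ StarAlgebra.adjoin ℂ (Set.range (S A)) := by
  induction hx using Submodule.span_induction with
  | mem x hx =>
    obtain ⟨α, β, F, _, _, rfl⟩ := hx
    refine mul_mem (mul_mem (word_mem_adjoin α) ?_) (star_mem (word_mem_adjoin β))
    refine Submonoid.noncommProd_mem (StarAlgebra.adjoin ℂ (Set.range (S A))).toSubmonoid
      _ _ _ fun i _ => ?_
    have h := StarAlgebra.subset_adjoin ℂ (Set.range (S A)) ⟨i, rfl⟩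
    exact (mul_mem (star_mem h) h : _ ∈ StarAlgebra.adjoin ℂ (Set.range (S A)))
  | zero => exact zero_mem _
  | add x y _ _ hx hy => exact add_mem hx hy
  | smul c x _ hx => exact SMulMemClass.smul_mem _ hx

theorem adjoin_le_wordSpan (hFS : FinitelySummable A) {x : Alg A}
    (hx : x ∈ StarAlgebra.adjoin ℂ (Set.range (S A))) : x ∈ wordSpan A := by
  have h := adjoin_mul_mem_wordSpan hFS hx 1 (by simpa using word_mem_wordSpan (A := A) [] [])
  rwa [mul_one] at h

theorem core_eq_wordSpan (hFS : FinitelySummable A) : core A = wordSpan A :=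
  le_antisymm (fun _ hx => adjoin_le_wordSpan hFS (core_le_adjoin hx)) wordSpan_le_core

theorem coe_adjoin_eq_core (hFS : FinitelySummable A) :
    (StarAlgebra.adjoin ℂ (Set.range (S A)) : Set (Alg A)) = core A :=
  Set.Subset.antisymm (fun _ hx => wordSpan_le_core (adjoin_le_wordSpan hFS hx))
    fun _ hx => core_le_adjoin hx

theorem dense_adjoin :
    Dense (StarAlgebra.adjoin ℂ (Set.range (S A)) : Set (Alg A)) := by
  intro x
  let ι : Alg A →⋆ₐ[ℂ] BigProduct A := (generated A).subtype
  have hmap : (StarAlgebra.adjoin ℂ (Set.range (S A))).map ι =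
      StarAlgebra.adjoin ℂ (Set.range (bigS A)) := by
    rw [StarAlgHom.map_adjoin, ← Set.range_comp]
    rfl
  have hind : IsInducing ι := IsInducing.subtypeVal
  rw [hind.closure_eq_preimage_closure_image, Set.mem_preimage]
  have h2 : ι '' (StarAlgebra.adjoin ℂ (Set.range (S A)) : Set (Alg A)) =
      (StarAlgebra.adjoin ℂ (Set.range (bigS A)) : Set (BigProduct A)) := by
    rw [← hmap]
    rfl
  rw [h2]
  exact x.2

theorem dense_core (hFS : FinitelySummable A) : Dense (core A : Set (Alg A)) :=
  coe_adjoin_eq_core hFS ▸ dense_adjoin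

end Core

/-! ### Stabilization of the approximations -/

section Limit

variable {A : ℕ → ℕ → Bool}

theorem exists_S_mul_word_eq_zero (hcol : ∀ j, (col A j).Finite) {α : List ℕ} (hα : α ≠ []) :
    ∃ N, (∀ i ≥ N, S A i * word A α = 0) ∧ ∀ n ≥ N, gap (S A) n * word A α = 0 := by
  cases α with
  | nil => exact absurd rfl hα
  | cons a α =>
    obtain ⟨N, hN⟩ := (hcol a).bddAbove
    refine ⟨max N a + 1, fun i hi => ?_, fun n hn => ?_⟩
    · rw [word_cons, ← mul_assoc, S_mul_S_eq_zero, zero_mul]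
      intro h
      have := hN h
      omega
    · rw [word_cons, ← mul_assoc, (isFamily_S A).gap_mul (by omega), zero_mul]

/-- Both the summands `S_i S_α S_β^* S_i^*` and the correction `Q_n S_α S_β^* Q_n` vanish for large
indices, unless both words are empty. -/
theorem exists_conj_eq_zero (hcol : ∀ j, (col A j).Finite) {α β : List ℕ}
    (h : α ≠ [] ∨ β ≠ []) :
    ∃ N, (∀ i ≥ N, S A i * (word A α * star (word A β)) * star (S A i) = 0) ∧
      ∀ n ≥ N, gap (S A) n * (word A α * star (word A β)) * gap (S A) n = 0 := by
  rcases h with h | h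
  · obtain ⟨N, h1, h2⟩ := exists_S_mul_word_eq_zero hcol h
    refine ⟨N, fun i hi => ?_, fun n hn => ?_⟩
    · rw [← mul_assoc, h1 i hi, zero_mul, zero_mul]
    · rw [← mul_assoc, h2 n hn, zero_mul, zero_mul]
  · obtain ⟨N, h1, h2⟩ := exists_S_mul_word_eq_zero hcol h
    refine ⟨N, fun i hi => ?_, fun n hn => ?_⟩
    · rw [mul_assoc, mul_assoc, ← star_mul, h1 i hi, star_zero, mul_zero, mul_zero]
    · rw [mul_assoc, mul_assoc, ← star_gap, ← star_mul, h2 n hn, star_zero, mul_zero, mul_zero]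

theorem exists_approx_word_eq (hcol : ∀ j, (col A j).Finite) {α β : List ℕ}
    (h : α ≠ [] ∨ β ≠ []) :
    ∃ N, (∀ i ≥ N, S A i * (word A α * star (word A β)) * star (S A i) = 0) ∧
      ∀ n ≥ N, approx (S A) n (word A α * star (word A β)) =
        ∑ i ∈ Finset.range N, S A i * (word A α * star (word A β)) * star (S A i) := by
  obtain ⟨N, h1, h2⟩ := exists_conj_eq_zero hcol h
  refine ⟨N, h1, fun n hn => ?_⟩
  rw [approx_apply, h2 n hn, add_zero]
  refine (Finset.sum_subset (Finset.range_mono hn) fun i _ hi => h1 i ?_).symm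
  simpa using hi

theorem exists_approx_eventually_eq (hcol : ∀ j, (col A j).Finite) {x : Alg A}
    (hx : x ∈ wordSpan A) :
    ∃ y ∈ wordSpan A, ∀ᶠ n in atTop, approx (S A) n x = y := by
  induction hx using Submodule.span_induction with
  | mem x hx =>
    obtain ⟨α, β, rfl⟩ := hx
    by_cases h : α ≠ [] ∨ β ≠ []
    · obtain ⟨N, -, h2⟩ := exists_approx_word_eq hcol h
      refine ⟨_, ?_, eventually_atTop.2 ⟨N, h2⟩⟩
      refine Submodule.sum_mem _ fun i _ => ?_
      have h3 := word_mem_wordSpan (A := A) (i :: α) (i :: β)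
      rwa [word_cons, word_cons, star_mul, mul_assoc, ← mul_assoc (word A α), ← mul_assoc] at h3
    · obtain ⟨rfl, rfl⟩ : α = [] ∧ β = [] := by simpa using h
      exact ⟨_, word_mem_wordSpan [] [], .of_forall fun n => by
        simp [(isFamily_S A).approx_one]⟩
  | zero => exact ⟨0, zero_mem _, .of_forall fun n => map_zero _⟩
  | add x x' _ _ hx hx' =>
    obtain ⟨y, hy, h⟩ := hx
    obtain ⟨y', hy', h'⟩ := hx'
    refine ⟨y + y', add_mem hy hy', ?_⟩
    filter_upwards [h, h'] with n hn hn'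
    rw [map_add, hn, hn']
  | smul c x _ hx =>
    obtain ⟨y, hy, h⟩ := hx
    refine ⟨c • y, Submodule.smul_mem _ c hy, ?_⟩
    filter_upwards [h] with n hn
    rw [map_smul, hn]

theorem exists_tendsto_approx (hcol : ∀ j, (col A j).Finite) (hFS : FinitelySummable A)
    (f : Alg A) : ∃ y, Tendsto (fun n => approx (S A) n f) atTop (𝓝 y) := by
  refine cauchySeq_tendsto_of_complete (Metric.cauchySeq_iff'.2 fun ε hε => ?_)
  obtain ⟨g, hg, hfg⟩ := Metric.dense_iff.1 (dense_core hFS) f (ε / 2) (half_pos hε)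
  rw [Metric.mem_ball, dist_comm, dist_eq_norm] at hg
  rw [core_eq_wordSpan hFS] at hfg
  obtain ⟨y, -, hy⟩ := exists_approx_eventually_eq hcol hfg
  obtain ⟨N, hN⟩ := eventually_atTop.1 hy
  have key : ∀ n ≥ N, dist (approx (S A) n f) y < ε / 2 := fun n hn => by
    rw [dist_eq_norm, ← hN n hn, ← map_sub]
    exact ((isFamily_S A).norm_approx_apply_le n _).trans_lt hg
  refine ⟨N, fun n hn => ?_⟩
  calc _ ≤ dist (approx (S A) n f) y + dist (approx (S A) N f) y := dist_triangle_right _ _ _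
    _ < ε / 2 + ε / 2 := add_lt_add (key n hn) (key N le_rfl)
    _ = ε := add_halves ε

end Limit

/-! ### The correction in the canonical representation -/

section Representation

variable {A : ℕ → ℕ → Bool}

theorem gap_T_apply (n : ℕ) (ξ : Hilb A) (x : Shift A) :
    gap (T A) n ξ x = if x.1 0 < n then 0 else ξ x := by
  induction n with
  | zero => simp [gap]
  | succ n ih =>
    have h : gap (T A) (n + 1) = gap (T A) n - T A n * star (T A n) := by
      rw [gap, gap, Finset.sum_range_succ, sub_sub]
    rw [h, sub_apply, lp.coeFn_sub, Pi.sub_apply, ih, T_mul_star_T_apply]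
    rcases lt_trichotomy (x.1 0) n with h1 | h1 | h1
    · simp [h1, h1.ne, h1.trans n.lt_succ_self]
    · simp [h1]
    · simp [h1.ne', not_lt.2 h1.le, not_lt.2 (Nat.succ_le_of_lt h1)]

theorem tendsto_gap_T (ξ : Hilb A) :
    Tendsto (fun n => gap (T A) n ξ) atTop (𝓝 0) := by
  have h2 : (0 : ℝ) < (2 : ℝ≥0∞).toReal := by norm_num
  have hsum : Tendsto (fun n => ‖gap (T A) n ξ‖ ^ (2 : ℝ≥0∞).toReal) atTop (𝓝 0) := by
    simp only [lp.norm_rpow_eq_tsum h2]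
    rw [← tsum_zero (α := ℝ) (β := Shift A)]
    refine tendsto_tsum_of_dominated_convergence ((lp.memℓp ξ).summable h2) (fun x => ?_)
      (.of_forall fun n x => ?_)
    · refine tendsto_const_nhds.congr' ?_
      filter_upwards [eventually_gt_atTop (x.1 0)] with n hn
      rw [gap_T_apply, if_pos hn, norm_zero, Real.zero_rpow h2.ne']
    · rw [gap_T_apply, Real.norm_of_nonneg (Real.rpow_nonneg (norm_nonneg _) _)]
      refine Real.rpow_le_rpow (norm_nonneg _) ?_ h2.le
      split_ifs <;> simp
  rw [tendsto_zero_iff_norm_tendsto_zero]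
  have h3 := hsum.rpow_const (p := (2 : ℝ≥0∞).toReal⁻¹) (Or.inr (inv_nonneg.2 h2.le))
  rw [Real.zero_rpow (inv_ne_zero h2.ne')] at h3
  exact h3.congr fun n => Real.rpow_rpow_inv (norm_nonneg _) h2.ne'

theorem canonicalRep_gap (n : ℕ) : canonicalRep A (gap (S A) n) = gap (T A) n := by
  simp only [gap, map_sub, map_one, map_sum, map_mul, map_star, canonicalRep, lift_S]

theorem tendsto_canonicalRep_gap_conj (f : Alg A) (ξ : Hilb A) :
    Tendsto (fun n => canonicalRep A (gap (S A) n * f * gap (S A) n) ξ) atTop (𝓝 0) := by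
  have hgap : ∀ (n : ℕ) (η : Hilb A), ‖gap (T A) n η‖ ≤ ‖η‖ := fun n η => by
    have h2 : (0 : ℝ) < (2 : ℝ≥0∞).toReal := by norm_num
    refine lp.norm_le_of_forall_sum_le h2 (norm_nonneg _) fun s => ?_
    refine le_trans (Finset.sum_le_sum fun x _ => ?_) (lp.sum_rpow_le_norm_rpow h2 η s)
    rw [gap_T_apply]
    refine Real.rpow_le_rpow (norm_nonneg _) ?_ h2.le
    split_ifs <;> simp
  have h := (tendsto_gap_T ξ).norm.const_mul ‖canonicalRep A f‖
  rw [norm_zero, mul_zero] at h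
  refine squeeze_zero_norm (fun n => ?_) h
  rw [map_mul, map_mul, canonicalRep_gap]
  exact (hgap n _).trans ((canonicalRep A f).le_opNorm _)

end Representation

end ExelLaca

/-! ### The map `γ_A` -/

open ExelLaca Filter in
/-- Under (UCF) and (FS), `𝒜_A` is a dense unital `*`-subalgebra of `𝒪_A`, the linear map `γ_A` on
`𝒜_A` is well defined (exists and is unique) and norm-contractive, and its unique continuous linear
extension to `𝒪_A` is a ucp map that is the point-strong limit of the maps
`f ↦ ∑_{i ≤ n} S_i f S_i^*` in the canonical representation on `ℓ²(Σ_A)`. -/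
theorem proposition3p5 (A : ℕ → ℕ → Bool)
    (hUCF : ExelLaca.UniformlyColumnFinite A) (hFS : ExelLaca.FinitelySummable A) :
    ((∃ B : StarSubalgebra ℂ (ExelLaca.Alg A),
        (B : Set (ExelLaca.Alg A)) = (ExelLaca.core A : Set (ExelLaca.Alg A))) ∧
      Dense (ExelLaca.core A : Set (ExelLaca.Alg A))) ∧
    ∃ γ₀ : ExelLaca.core A →ₗ[ℂ] ExelLaca.core A,
      ExelLaca.IsGamma A γ₀ ∧
      (∀ γ' : ExelLaca.core A →ₗ[ℂ] ExelLaca.core A, ExelLaca.IsGamma A γ' → γ' = γ₀) ∧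
      (∀ f : ExelLaca.core A, ‖γ₀ f‖ ≤ ‖f‖) ∧
      ∃ γ : ExelLaca.Alg A →L[ℂ] ExelLaca.Alg A,
        (∀ f : ExelLaca.core A, γ (f : ExelLaca.Alg A) = (γ₀ f : ExelLaca.Alg A)) ∧
        (∀ γ' : ExelLaca.Alg A →L[ℂ] ExelLaca.Alg A,
          (∀ f : ExelLaca.core A, γ' (f : ExelLaca.Alg A) = (γ₀ f : ExelLaca.Alg A)) → γ' = γ) ∧
        γ 1 = 1 ∧
        (∃ Φ : ExelLaca.Alg A →CP ExelLaca.Alg A, ∀ f, Φ f = γ f) ∧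
        ∀ (f : ExelLaca.Alg A) (ξ : ExelLaca.Hilb A),
          Filter.Tendsto
            (fun n : ℕ => ExelLaca.canonicalRep A
              (∑ i ∈ Finset.range n, ExelLaca.S A i * f * star (ExelLaca.S A i)) ξ)
            Filter.atTop (nhds (ExelLaca.canonicalRep A (γ f) ξ)) := by
  have hcol : ∀ j, (col A j).Finite := by
    obtain ⟨M, hM⟩ := hUCF
    exact fun j => Set.finite_of_encard_le_coe (hM j)
  refine ⟨⟨⟨StarAlgebra.adjoin ℂ (Set.range (S A)), coe_adjoin_eq_core hFS⟩, dense_core hFS⟩, ?_⟩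
  choose γf hγf using exists_tendsto_approx hcol hFS
  let γ : Alg A →L[ℂ] Alg A :=
    continuousLinearMapOfTendsto (fun n => approx (S A) n) (f := γf) (l := atTop)
      (tendsto_pi_nhds.2 hγf)
  have hγ : ∀ f, Tendsto (fun n => approx (S A) n f) atTop (nhds (γ f)) := hγf
  have hγ_eq : ∀ {f y : Alg A}, (∀ᶠ n in atTop, approx (S A) n f = y) → γ f = y := fun h =>
    tendsto_nhds_unique (hγ _) (tendsto_const_nhds.congr' (h.mono fun _ hn => hn.symm))
  have hcore : ∀ f ∈ core A, γ f ∈ core A := by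
    rw [core_eq_wordSpan hFS]
    intro f hf
    obtain ⟨y, hy, h⟩ := exists_approx_eventually_eq hcol hf
    rwa [hγ_eq h]
  have hone : γ 1 = 1 := hγ_eq (.of_forall fun n => (isFamily_S A).approx_one n)
  have hnorm : ∀ f, ‖γ f‖ ≤ ‖f‖ := fun f =>
    le_of_tendsto (hγ f).norm (.of_forall fun n => (isFamily_S A).norm_approx_apply_le n f)
  let γ₀ : core A →ₗ[ℂ] core A := (γ : Alg A →ₗ[ℂ] Alg A).restrict hcore
  have hγ₀ : ∀ f : core A, (γ₀ f : Alg A) = γ f := fun _ => rfl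
  have hgamma : IsGamma A γ₀ := by
    refine ⟨fun x hx => by rw [hγ₀, hx, hone], fun α β _ _ x hx hx1 => ?_⟩
    have hαβ : α ≠ [] ∨ β ≠ [] := by
      by_contra! h
      obtain ⟨rfl, rfl⟩ := h
      exact hx1 (by rw [hx, word_nil, star_one, mul_one])
    obtain ⟨N, h1, h2⟩ := exists_approx_word_eq hcol hαβ
    rw [hγ₀, hx]
    have hsub : (Function.support fun i => S A i * (word A α * star (word A β)) * star (S A i)) ⊆
        Finset.range N := by
      intro i hi
      rw [Finset.coe_range, Set.mem_Iio]
      by_contra hiN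
      exact hi (h1 i (not_lt.1 hiN))
    refine ⟨(Finset.finite_toSet _).subset hsub, ?_⟩
    rw [finsum_eq_sum_of_support_subset _ hsub]
    exact hγ_eq (eventually_atTop.2 ⟨N, h2⟩)
  refine ⟨γ₀, hgamma, fun γ' hγ' => ?_, fun f => hnorm f, γ, fun f => rfl, fun γ' hγ' => ?_, hone,
    ⟨⟨γ, fun k M hM => map_nonneg_of_tendsto hγ fun n => map_approx_nonneg (S A) n hM⟩,
      fun f => rfl⟩, fun f ξ => ?_⟩
  · -- `γ'` is determined on the spanning elements `S_α S_β^*`; those equal to `1` fall under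
    -- `γ(1) = 1`.
    have key : ∀ x, ∀ hx : x ∈ wordSpan A,
        γ' ⟨x, wordSpan_le_core hx⟩ = γ₀ ⟨x, wordSpan_le_core hx⟩ := by
      intro x hx
      induction hx using Submodule.span_induction with
      | mem x hx =>
        obtain ⟨α, β, rfl⟩ := hx
        by_cases hα : Admissible A α
        · by_cases hβ : Admissible A β
          · by_cases h1 : word A α * star (word A β) = 1
            · exact Subtype.ext ((hγ'.map_one _ h1).trans (hgamma.map_one _ h1).symm)
            · exact Subtype.ext ((hγ'.map_word α β hα hβ _ rfl h1).2.trans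
                (hgamma.map_word α β hα hβ _ rfl h1).2.symm)
          · simp only [word_eq_zero hβ, star_zero, mul_zero]
            exact (map_zero γ').trans (map_zero γ₀).symm
        · simp only [word_eq_zero hα, zero_mul]
          exact (map_zero γ').trans (map_zero γ₀).symm
      | zero => exact (map_zero γ').trans (map_zero γ₀).symm
      | add x y hx hy ihx ihy =>
        have h := map_add γ' ⟨x, wordSpan_le_core hx⟩ ⟨y, wordSpan_le_core hy⟩
        rw [ihx, ihy, ← map_add] at h
        exact h
      | smul c x hx ih =>
        have h := map_smul γ' c ⟨x, wordSpan_le_core hx⟩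
        rw [ih, ← map_smul] at h
        exact h
    refine LinearMap.ext fun f => key f.1 ?_
    exact core_eq_wordSpan hFS ▸ f.2
  · refine ContinuousLinearMap.ext fun f => congrFun ?_ f
    exact Continuous.ext_on (dense_core hFS) γ'.continuous γ.continuous fun f hf => hγ' ⟨f, hf⟩
  · have hrep : Continuous (canonicalRep A) := map_continuous (canonicalRep A)
    have h1 : Tendsto (fun n => canonicalRep A (approx (S A) n f) ξ) atTop
        (nhds (canonicalRep A (γ f) ξ)) :=
      ((ContinuousLinearMap.apply ℂ (Hilb A) ξ).continuous.comp hrep).continuousAt.tendsto.comp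
        (hγ f)
    have h2 := h1.sub (tendsto_canonicalRep_gap_conj f ξ)
    rw [sub_zero] at h2
    refine h2.congr fun n => ?_
    rw [approx_apply, map_add, add_apply, add_sub_cancel_right]
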